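/- Let $d \ge 1$ and let $p(z,x_1,\dots,x_n) = c_d(x)\,z^d + c_{d-1}(x)\,z^{d-1} + \dots + c_0(x)$, with $c_0,\dots,c_d \in \mathbb{R}[x_1,\dots,x_n]$ and $c_d \neq 0$, be a polynomial of degree $d$ in $z$. For $i \ge 1$ let $p^{(i)}$ denote the $i$-th derivative of $p$ with respect to $z$, and let $\operatorname{res}_z(p,p^{(i)}) \in \mathbb{R}[x_1,\dots,x_n]$ be the resultant with respect to $z$, i.e. the determinant of the Sylvester matrix of $p$ and $p^{(i)}$ regarded as polynomials in $z$ of degrees $d$ and $d-i$. Define $$A = \{ a \in \mathbb{R}^n : \operatorname{res}_z(p,p^{(i)})(a) \neq 0 \text{ for all } i = 1,\dots,d \}.$$ Then $A$ is an open subset of $\mathbb{R}^n$, and for each connected component $C$ of $A$ there are an integer $k \ge 0$ and functions $r_1,\dots,r_k : C \to \mathbb{R}$ such that: 1. $r_1,\dots,r_k$ are continuous on $C$, and for each $a \in C$ we have $r_1(a) < \dots < r_k(a)$ and the set of real roots of $p(z,a)$ in $z$ is $\{r_1(a),\dots,r_k(a)\}$. 2. For all $i = 1,\dots,d$ and $j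 = 1,\dots,k$, the sign $\sigma_{i,j} := \operatorname{sign}\big(p^{(i)}(r_j(a),a)\big)$ is nonzero and does not depend on $a \in C$. 3. For all $j = 1,\dots,k$, $a \in C$ and $z \in \mathbb{R}$: $z = r_j(a)$ if and only if $p(z,a) = 0$ and $\operatorname{sign}\big(p^{(i)}(z,a)\big) = \sigma_{i,j}$ for all $i = 1,\dots,d$. -/

import Mathlib

open Polynomial

noncomputable section

/-- The value at `z ∈ ℝ`, `a ∈ ℝⁿ` of a polynomial in the main variable `z` whose coefficients
are real polynomials in `x₁, …, xₙ`. -/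
def evalAt {n : ℕ} (p : (MvPolynomial (Fin n) ℝ)[X]) (z : ℝ) (a : Fin n → ℝ) : ℝ :=
  (p.map (MvPolynomial.eval a)).eval z

/-- The `i`-th derivative of `p` with respect to the main variable `z`. -/
def zDeriv {n : ℕ} (p : (MvPolynomial (Fin n) ℝ)[X]) (i : ℕ) : (MvPolynomial (Fin n) ℝ)[X] :=
  Polynomial.derivative^[i] p

/-- The set of `a ∈ ℝⁿ` at which none of the polynomials `res_z (p, p⁽ⁱ⁾)`, `1 ≤ i ≤ deg_z p`,
vanishes. The resultant is the determinant of the Sylvester matrix formed over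
`ℝ[x₁, …, xₙ]`, for the degrees of `p` and `p⁽ⁱ⁾` in `z`; it is then evaluated at `a`. -/
def regularSet {n : ℕ} (p : (MvPolynomial (Fin n) ℝ)[X]) : Set (Fin n → ℝ) :=
  {a | ∀ i : ℕ, 1 ≤ i → i ≤ p.natDegree →
    MvPolynomial.eval a (Polynomial.resultant p (zDeriv p i)) ≠ 0}

end

/-! Thom's lemma: if all derivatives of `f` have equal signs at `x` and at `y`, then they keep these
signs on `[x, y]`, because inductively `f'` has constant sign there, so that `f` is monotone. Hence
a nonzero `f` vanishes at most once for each sign pattern of its derivatives.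

Over the regular set the roots and their sign patterns depend locally constantly on the parameter.
A root is simple, so it persists, and its pattern has no zero entry, so it persists as well. No new
pattern appears, because the leading coefficient does not vanish, which confines the roots to a
compact set (Cauchy's bound), and in a compact set they can only accumulate at roots of the limit.
So the set of patterns is constant on a connected set, each pattern selects one root, and the
selected roots are continuous and never meet, which preserves their order. -/

open Filter Topology
open SignType (sign)

/-- The Thom code of `z` with respect to `f`: the signs at `z` of `f` and all its derivatives.
The `0`-th entry and those past the degree, which are `0` at a root, are kept so that agreement
of codes is an equality of functions. -/
noncomputable def thomCode (f : ℝ[X]) (z : ℝ) (i : ℕ) : SignType :=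
  sign ((derivative^[i] f).eval z)

/-- The Thom codes realized by the real roots of `f`. -/
def rootThomCodes (f : ℝ[X]) : Set (ℕ → SignType) :=
  thomCode f '' {z | f.IsRoot z}

/-- A nonzero polynomial none of whose derivatives, up to the order of its degree, vanishes at one
of its roots, as holds for the specializations of a polynomial at the points of its `regularSet`. -/
structure IsThomRegular {R : Type*} [Semiring R] (f : R[X]) : Prop where
  ne_zero : f ≠ 0
  eval_iterate_derivative_ne_zero :
    ∀ z, f.IsRoot z → ∀ i, 1 ≤ i → i ≤ f.natDegree → (derivative^[i] f).eval z ≠ 0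

/-- Coefficientwise convergence of polynomials without loss of degree in the limit, the degree
condition being what keeps roots from escaping to infinity. -/
structure TendstoCoeffwise {ι R : Type*} [Semiring R] [TopologicalSpace R]
    (f : ι → R[X]) (l : Filter ι) (g : R[X]) : Prop where
  natDegree_le : ∀ᶠ t in l, (f t).natDegree ≤ g.natDegree
  tendsto_coeff : ∀ i, Tendsto (fun t => (f t).coeff i) l (𝓝 (g.coeff i))

section ThomLemma

variable {f g : ℝ[X]} {x y z w : ℝ}

theorem thomCode_zero_eq_zero_iff : thomCode f z 0 = 0 ↔ f.IsRoot z :=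
  sign_eq_zero_iff

theorem monotoneOn_or_antitoneOn_of_sign_derivative_eq {s : Set ℝ} (hs : Convex ℝ s)
    {σ : SignType} (hσ : ∀ t ∈ s, sign ((derivative f).eval t) = σ) :
    MonotoneOn (fun t => f.eval t) s ∨ AntitoneOn (fun t => f.eval t) s := by
  have hderiv : ∀ t ∈ interior s, sign (deriv (fun t => f.eval t) t) = σ := fun t ht => by
    rw [Polynomial.deriv, hσ t (interior_subset ht)]
  rcases le_total 0 σ with h | h
  · exact .inl <| monotoneOn_of_deriv_nonneg hs f.continuous.continuousOn
      f.differentiable.differentiableOn fun t ht =>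
        sign_nonneg_iff.1 (h.trans_eq (hderiv t ht).symm)
  · exact .inr <| antitoneOn_of_deriv_nonpos hs f.continuous.continuousOn
      f.differentiable.differentiableOn fun t ht =>
        sign_nonpos_iff.1 ((hderiv t ht).trans_le h)

theorem sign_eval_eq_of_mem_Icc {σ : SignType}
    (hσ : ∀ t ∈ Set.Icc x y, sign ((derivative f).eval t) = σ)
    (hxy : sign (f.eval x) = sign (f.eval y)) (hz : z ∈ Set.Icc x y) :
    sign (f.eval z) = sign (f.eval x) := by
  have hx : x ∈ Set.Icc x y := Set.left_mem_Icc.2 (hz.1.trans hz.2)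
  have hy : y ∈ Set.Icc x y := Set.right_mem_Icc.2 (hz.1.trans hz.2)
  rcases monotoneOn_or_antitoneOn_of_sign_derivative_eq (convex_Icc x y) hσ with hf | hf
  · exact le_antisymm ((sign.monotone (hf hz hy hz.2)).trans_eq hxy.symm)
      (sign.monotone (hf hx hz hz.1))
  · exact le_antisymm (sign.monotone (hf hx hz hz.1))
      (hxy.trans_le (sign.monotone (hf hz hy hz.2)))

theorem thomCode_eq_of_mem_Icc (hxy : thomCode f x = thomCode f y) (hz : z ∈ Set.Icc x y) :
    thomCode f z = thomCode f x := by
  obtain ⟨n, hn⟩ : ∃ n, derivative^[n] f = 0 :=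
    ⟨f.natDegree + 1, iterate_derivative_eq_zero (Nat.lt_succ_self _)⟩
  induction n generalizing f z with
  | zero =>
    obtain rfl : f = 0 := hn
    funext i
    simp only [thomCode, iterate_derivative_zero, eval_zero]
  | succ n ih =>
    have hderiv : ∀ t ∈ Set.Icc x y, thomCode (derivative f) t = thomCode (derivative f) x :=
      fun t ht => ih (funext fun i => congrFun hxy (i + 1)) ht hn
    funext i
    cases i with
    | zero =>
      exact sign_eval_eq_of_mem_Icc (fun t ht => congrFun (hderiv t ht) 0) (congrFun hxy 0) hz
    | succ i => exact congrFun (hderiv z hz) i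

theorem thomCode_injOn_roots (hf : f ≠ 0) : Set.InjOn (thomCode f) {z | f.IsRoot z} := by
  intro x hx y hy hxy
  wlog hle : x ≤ y generalizing x y
  · exact (this hy hx hxy.symm (le_of_not_ge hle)).symm
  by_contra hne
  refine hf (eq_zero_of_infinite_isRoot f ((Set.Icc_infinite (hle.lt_of_ne hne)).mono ?_))
  intro t ht
  rw [Set.mem_ofPred_eq, ← thomCode_zero_eq_zero_iff, thomCode_eq_of_mem_Icc hxy ht]
  exact thomCode_zero_eq_zero_iff.2 hx

theorem thomCode_eq_iff_of_isRoot {d : ℕ} (hf : f.natDegree ≤ d) (hg : g.natDegree ≤ d)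
    (hz : f.IsRoot z) (hw : g.IsRoot w) :
    thomCode f z = thomCode g w ↔
      ∀ i, 1 ≤ i → i ≤ d → thomCode f z i = thomCode g w i := by
  refine ⟨fun h i _ _ => congrFun h i, fun h => funext fun i => ?_⟩
  rcases i.eq_zero_or_pos with rfl | hi
  · rw [thomCode_zero_eq_zero_iff.2 hz, thomCode_zero_eq_zero_iff.2 hw]
  rcases le_or_gt i d with hid | hid
  · exact h i hi hid
  · simp only [thomCode, iterate_derivative_eq_zero (hf.trans_lt hid),
      iterate_derivative_eq_zero (hg.trans_lt hid), eval_zero]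

end ThomLemma

namespace TendstoCoeffwise

section Semiring

variable {ι R : Type*} [Semiring R] [TopologicalSpace R] {f : ι → R[X]} {l : Filter ι} {g : R[X]}

theorem eventually_natDegree_eq [T1Space R] (hf : TendstoCoeffwise f l g) (hg : g ≠ 0) :
    ∀ᶠ t in l, (f t).natDegree = g.natDegree := by
  filter_upwards [hf.natDegree_le,
    (hf.tendsto_coeff g.natDegree).eventually_ne (leadingCoeff_ne_zero.2 hg)] with t hle hne
  exact hle.antisymm (le_natDegree_of_ne_zero hne)

variable [IsTopologicalSemiring R]

theorem iterate_derivative [IsAddTorsionFree R] (hf : TendstoCoeffwise f l g) (k : ℕ) :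
    TendstoCoeffwise (fun t => derivative^[k] (f t)) l (derivative^[k] g) := by
  induction k with
  | zero => exact hf
  | succ k ih =>
    simp only [Function.iterate_succ_apply']
    refine ⟨?_, fun i => ?_⟩
    · filter_upwards [ih.natDegree_le] with t ht
      simpa only [natDegree_derivative] using Nat.sub_le_sub_right ht 1
    · simpa only [coeff_derivative] using (ih.tendsto_coeff (i + 1)).mul_const _

theorem tendsto_eval_prod (hf : TendstoCoeffwise f l g) (z : R) :
    Tendsto (fun q : ι × R => (f q.1).eval q.2) (l ×ˢ 𝓝 z) (𝓝 (g.eval z)) := by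
  have hsum : Tendsto
      (fun q : ι × R => ∑ i ∈ Finset.range (g.natDegree + 1), (f q.1).coeff i * q.2 ^ i)
      (l ×ˢ 𝓝 z) (𝓝 (g.eval z)) := by
    rw [eval_eq_sum_range]
    exact tendsto_finsetSum _ fun i _ =>
      ((hf.tendsto_coeff i).comp tendsto_fst).mul (tendsto_snd.pow i)
  refine hsum.congr' ?_
  filter_upwards [hf.natDegree_le.prod_inl (𝓝 z)] with q hq
  exact (eval_eq_sum_range' (Nat.lt_succ_of_le hq) _).symm

theorem tendsto_eval (hf : TendstoCoeffwise f l g) (z : R) :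
    Tendsto (fun t => (f t).eval z) l (𝓝 (g.eval z)) :=
  (hf.tendsto_eval_prod z).comp (tendsto_id.prodMk tendsto_const_nhds)

end Semiring

section CauchyBound

variable {ι K : Type*} [NormedDivisionRing K] {f : ι → K[X]} {l : Filter ι} {g : K[X]}

theorem tendsto_cauchyBound (hf : TendstoCoeffwise f l g) (hg : g ≠ 0) :
    Tendsto (fun t => (f t).cauchyBound) l (𝓝 g.cauchyBound) := by
  have hsup := Tendsto.finset_sup_nhds_apply (s := Finset.range g.natDegree)
    fun i _ => (hf.tendsto_coeff i).nnnorm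
  have hlead := (hf.tendsto_coeff g.natDegree).nnnorm
  refine ((hsup.div hlead (nnnorm_ne_zero_iff.2 (leadingCoeff_ne_zero.2 hg))).add_const 1).congr' ?_
  filter_upwards [hf.eventually_natDegree_eq hg] with t ht
  simp only [cauchyBound, leadingCoeff, ht, Pi.div_apply]

theorem exists_isCompact_forall_isRoot_mem [ProperSpace K] (hf : TendstoCoeffwise f l g)
    (hg : g ≠ 0) : ∃ s : Set K, IsCompact s ∧ ∀ᶠ t in l, ∀ z, (f t).IsRoot z → z ∈ s := by
  refine ⟨_, isCompact_closedBall 0 (g.cauchyBound + 1), ?_⟩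
  filter_upwards [(hf.tendsto_cauchyBound hg).eventually_lt_const (lt_add_one _),
    (hf.tendsto_coeff g.natDegree).eventually_ne (leadingCoeff_ne_zero.2 hg)] with t hlt hne z hz
  have hft : f t ≠ 0 := fun h => hne (by rw [h, coeff_zero])
  exact mem_closedBall_zero_iff.2 (mod_cast ((hz.norm_lt_cauchyBound hft).trans hlt).le)

end CauchyBound

end TendstoCoeffwise

theorem eventually_sign_eval_eq_of_isRoot {f : ℝ[X]} {z : ℝ} (hz : f.IsRoot z)
    (hz' : (derivative f).eval z ≠ 0) :
    ∀ᶠ t in 𝓝 z, sign (f.eval t) = sign ((derivative f).eval z) * sign (t - z) := by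
  rw [← Polynomial.deriv] at hz' ⊢
  rcases hz'.lt_or_gt with hneg | hpos
  · filter_upwards [eventually_nhdsWithin_sign_eq_of_deriv_neg hneg hz] with t ht
    rw [ht, sign_neg hneg, ← neg_sub t z, Left.sign_neg, neg_one_mul]
  · filter_upwards [eventually_nhdsWithin_sign_eq_of_deriv_pos hpos hz] with t ht
    rw [ht, sign_pos hpos, one_mul]

theorem exists_Icc_subset_eval_mul_eval_neg {f : ℝ[X]} {z : ℝ} (hz : f.IsRoot z)
    (hz' : (derivative f).eval z ≠ 0) {U : Set ℝ} (hU : U ∈ 𝓝 z) :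
    ∃ u v, u ≤ v ∧ Set.Icc u v ⊆ U ∧ f.eval u * f.eval v < 0 := by
  obtain ⟨ε, hε, hball⟩ := Metric.nhds_basis_closedBall.mem_iff.1
    (inter_mem hU (eventually_sign_eval_eq_of_isRoot hz hz'))
  rw [Real.closedBall_eq_Icc] at hball
  have hle : z - ε ≤ z + ε := by linarith
  have hu := (hball (Set.left_mem_Icc.2 hle)).2
  have hv := (hball (Set.right_mem_Icc.2 hle)).2
  refine ⟨z - ε, z + ε, hle, fun t ht => (hball ht).1, sign_eq_neg_one_iff.1 ?_⟩
  rw [Set.mem_ofPred_eq, sign_neg (by linarith : z - ε - z < 0)] at hu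
  rw [Set.mem_ofPred_eq, sign_pos (by linarith : 0 < z + ε - z)] at hv
  rw [sign_mul, hu, hv, mul_one, mul_neg_one, neg_mul, ← sign_mul, sign_pos (mul_self_pos.2 hz')]

theorem exists_isRoot_mem_Icc_of_eval_mul_eval_neg {f : ℝ[X]} {u v : ℝ} (huv : u ≤ v)
    (hneg : f.eval u * f.eval v < 0) : ∃ w ∈ Set.Icc u v, f.IsRoot w := by
  rw [← Set.uIcc_of_le huv]
  refine intermediate_value_uIcc f.continuous.continuousOn (Set.mem_uIcc.2 ?_)
  rcases mul_neg_iff.1 hneg with h | h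
  · exact .inr ⟨h.2.le, h.1.le⟩
  · exact .inl ⟨h.1.le, h.2.le⟩

theorem IsThomRegular.eval_derivative_ne_zero {R : Type*} [Semiring R] {f : R[X]}
    (hf : IsThomRegular f) {z : R} (hz : f.IsRoot z) : (derivative f).eval z ≠ 0 :=
  hf.eval_iterate_derivative_ne_zero z hz 1 le_rfl
    (natDegree_pos_iff_degree_pos.2 (degree_pos_of_root hf.ne_zero hz))

namespace TendstoCoeffwise

variable {ι : Type*} {f : ι → ℝ[X]} {l : Filter ι} {g : ℝ[X]} {z : ℝ}

theorem eventually_exists_isRoot_mem (hf : TendstoCoeffwise f l g) (hz : g.IsRoot z)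
    (hz' : (derivative g).eval z ≠ 0) {U : Set ℝ} (hU : U ∈ 𝓝 z) :
    ∀ᶠ t in l, ∃ w ∈ U, (f t).IsRoot w := by
  obtain ⟨u, v, huv, hsub, hneg⟩ := exists_Icc_subset_eval_mul_eval_neg hz hz' hU
  filter_upwards [((hf.tendsto_eval u).mul (hf.tendsto_eval v)).eventually_lt_const hneg] with t ht
  obtain ⟨w, hw, hroot⟩ := exists_isRoot_mem_Icc_of_eval_mul_eval_neg huv ht
  exact ⟨w, hsub hw, hroot⟩

theorem eventually_thomCode_apply_eq (hf : TendstoCoeffwise f l g) {i : ℕ}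
    (hi : (derivative^[i] g).eval z ≠ 0) :
    ∀ᶠ q in l ×ˢ 𝓝 z, thomCode (f q.1) q.2 i = thomCode g z i := by
  have h := (continuousAt_sign_of_ne_zero hi).tendsto.comp
    ((hf.iterate_derivative i).tendsto_eval_prod z)
  rwa [nhds_discrete SignType, tendsto_pure] at h

theorem eventually_thomCode_eq (hf : TendstoCoeffwise f l g) (hg : IsThomRegular g)
    (hz : g.IsRoot z) :
    ∀ᶠ q in l ×ˢ 𝓝 z, (f q.1).IsRoot q.2 → thomCode (f q.1) q.2 = thomCode g z := by
  have hcode : ∀ i ∈ Finset.Icc 1 g.natDegree,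
      ∀ᶠ q in l ×ˢ 𝓝 z, thomCode (f q.1) q.2 i = thomCode g z i := fun i hi =>
    hf.eventually_thomCode_apply_eq <| hg.eval_iterate_derivative_ne_zero z hz i
      (Finset.mem_Icc.1 hi).1 (Finset.mem_Icc.1 hi).2
  filter_upwards [(eventually_all_finset _).2 hcode, hf.natDegree_le.prod_inl (𝓝 z)]
    with q hq hdeg hroot
  exact (thomCode_eq_iff_of_isRoot hdeg le_rfl hroot hz).2 fun i h1 hi =>
    hq i (Finset.mem_Icc.2 ⟨h1, hi⟩)

theorem eventually_exists_isRoot_thomCode_eq (hf : TendstoCoeffwise f l g)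
    (hg : IsThomRegular g) (hz : g.IsRoot z) {U : Set ℝ} (hU : U ∈ 𝓝 z) :
    ∀ᶠ t in l, ∃ w ∈ U, (f t).IsRoot w ∧ thomCode (f t) w = thomCode g z := by
  obtain ⟨P, hP, Q, hQ, hPQ⟩ := eventually_prod_iff.1 (hf.eventually_thomCode_eq hg hz)
  filter_upwards [hP, hf.eventually_exists_isRoot_mem hz (hg.eval_derivative_ne_zero hz)
    (inter_mem hU hQ)] with t ht ⟨w, hw, hroot⟩
  exact ⟨w, hw.1, hroot, hPQ ht hw.2 hroot⟩

theorem eventually_rootThomCodes_subset (hf : TendstoCoeffwise f l g) (hg : IsThomRegular g) :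
    ∀ᶠ t in l, rootThomCodes (f t) ⊆ rootThomCodes g := by
  obtain ⟨s, hs, hmem⟩ := hf.exists_isCompact_forall_isRoot_mem hg.ne_zero
  have hlocal : ∀ z ∈ s, ∀ᶠ q in l ×ˢ 𝓝 z,
      (f q.1).IsRoot q.2 → thomCode (f q.1) q.2 ∈ rootThomCodes g := by
    intro z _
    by_cases hz : g.IsRoot z
    · filter_upwards [hf.eventually_thomCode_eq hg hz] with q hq hroot
      exact hq hroot ▸ Set.mem_image_of_mem _ hz
    · filter_upwards [(hf.tendsto_eval_prod z).eventually_ne hz] with q hq hroot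
      exact absurd hroot hq
  obtain ⟨P, hP, Q, hQ, hPQ⟩ := eventually_prod_iff.1 (hs.mem_prod_nhdsSet_of_forall hlocal)
  filter_upwards [hmem, hP] with t hroots ht
  rintro _ ⟨w, hw, rfl⟩
  exact hPQ ht (hQ.self_of_nhdsSet w (hroots w hw)) hw

theorem eventually_subset_rootThomCodes (hf : TendstoCoeffwise f l g) (hg : IsThomRegular g) :
    ∀ᶠ t in l, rootThomCodes g ⊆ rootThomCodes (f t) := by
  have hpersist : ∀ z ∈ {z | g.IsRoot z}, ∀ᶠ t in l, thomCode g z ∈ rootThomCodes (f t) := by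
    intro z hz
    filter_upwards [hf.eventually_exists_isRoot_thomCode_eq hg hz univ_mem] with t ⟨w, _, hw⟩
    exact ⟨w, hw⟩
  filter_upwards [(eventually_all_finite (finite_setOfPred_isRoot hg.ne_zero)).2 hpersist] with t ht
  exact Set.image_subset_iff.2 ht

theorem eventually_rootThomCodes_eq (hf : TendstoCoeffwise f l g) (hg : IsThomRegular g) :
    ∀ᶠ t in l, rootThomCodes (f t) = rootThomCodes g :=
  (hf.eventually_rootThomCodes_subset hg).mp <|
    (hf.eventually_subset_rootThomCodes hg).mono fun _ h h' => h'.antisymm h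

end TendstoCoeffwise

theorem lt_of_isPreconnected_of_continuousOn_of_ne {T α : Type*} [TopologicalSpace T]
    [LinearOrder α] [TopologicalSpace α] [OrderClosedTopology α] {C : Set T}
    (hC : IsPreconnected C) {u v : T → α} (hu : ContinuousOn u C) (hv : ContinuousOn v C)
    (hne : ∀ a ∈ C, u a ≠ v a) {a b : T} (ha : a ∈ C) (hb : b ∈ C) (hlt : u a < v a) :
    u b < v b := by
  by_contra! hle
  obtain ⟨c, hc, heq⟩ := hC.intermediate_value₂ ha hb hu hv hlt.le hle
  exact hne c hc heq

theorem exists_strictMono_range_eq_roots {R : Type*} [CommRing R] [IsDomain R] [LinearOrder R]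
    {g : R[X]} (hg : g ≠ 0) :
    ∃ (k : ℕ) (e : Fin k → R), StrictMono e ∧ Set.range e = {z | g.IsRoot z} := by
  have hfin := finite_setOfPred_isRoot hg
  refine ⟨_, hfin.toFinset.orderEmbOfFin rfl, OrderEmbedding.strictMono _, ?_⟩
  rw [Finset.range_orderEmbOfFin, hfin.coe_toFinset]

section RootFunctions

variable {T : Type*} [TopologicalSpace T] {C : Set T} {f : T → ℝ[X]}

theorem rootThomCodes_eq_of_isPreconnected (hC : IsPreconnected C)
    (hf : ∀ a ∈ C, TendstoCoeffwise f (𝓝[C] a) (f a)) (hreg : ∀ a ∈ C, IsThomRegular (f a))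
    {a b : T} (ha : a ∈ C) (hb : b ∈ C) : rootThomCodes (f a) = rootThomCodes (f b) :=
  hC.induction₂ (fun a b => rootThomCodes (f a) = rootThomCodes (f b))
    (fun a ha => ((hf a ha).eventually_rootThomCodes_eq (hreg a ha)).mono fun _ => Eq.symm)
    (fun _ _ _ _ _ _ => Eq.trans) (fun _ _ _ _ => Eq.symm) ha hb

theorem continuousOn_of_thomCode_eq (hf : ∀ a ∈ C, TendstoCoeffwise f (𝓝[C] a) (f a))
    (hreg : ∀ a ∈ C, IsThomRegular (f a)) {s : ℕ → SignType} {r : T → ℝ}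
    (hr : ∀ a ∈ C, (f a).IsRoot (r a) ∧ thomCode (f a) (r a) = s) : ContinuousOn r C := by
  refine fun a ha U hU => mem_map.2 ?_
  filter_upwards [(hf a ha).eventually_exists_isRoot_thomCode_eq (hreg a ha) (hr a ha).1 hU,
    self_mem_nhdsWithin] with b ⟨w, hwU, hw, hcode⟩ hb
  have hwr : w = r b := thomCode_injOn_roots (hreg b hb).ne_zero hw (hr b hb).1
    (by rw [hcode, (hr a ha).2, (hr b hb).2])
  rwa [Set.mem_preimage, ← hwr]

theorem exists_continuousOn_isRoot_thomCode_eq (hC : IsPreconnected C)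
    (hf : ∀ a ∈ C, TendstoCoeffwise f (𝓝[C] a) (f a)) (hreg : ∀ a ∈ C, IsThomRegular (f a))
    {a₀ : T} (ha₀ : a₀ ∈ C) {s : ℕ → SignType} (hs : s ∈ rootThomCodes (f a₀)) :
    ∃ r : T → ℝ, ContinuousOn r C ∧
      ∀ a ∈ C, (f a).IsRoot (r a) ∧ thomCode (f a) (r a) = s := by
  have hex : ∀ a ∈ C, ∃ z, (f a).IsRoot z ∧ thomCode (f a) z = s := fun a ha =>
    (rootThomCodes_eq_of_isPreconnected hC hf hreg ha₀ ha).subset hs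
  choose! r hr using hex
  exact ⟨r, continuousOn_of_thomCode_eq hf hreg hr, hr⟩

theorem exists_root_functions_of_isConnected (hC : IsConnected C)
    (hf : ∀ a ∈ C, TendstoCoeffwise f (𝓝[C] a) (f a)) (hreg : ∀ a ∈ C, IsThomRegular (f a)) :
    ∃ (k : ℕ) (r : Fin k → T → ℝ) (s : Fin k → ℕ → SignType),
      (∀ j, ContinuousOn (r j) C) ∧ (∀ a ∈ C, StrictMono fun j => r j a) ∧
      (∀ a ∈ C, {z | (f a).IsRoot z} = Set.range fun j => r j a) ∧
      ∀ j, ∀ a ∈ C, thomCode (f a) (r j a) = s j := by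
  obtain ⟨a₀, ha₀⟩ := hC.nonempty
  have hinj := fun a ha => thomCode_injOn_roots (hreg a ha).ne_zero
  obtain ⟨k, e, he, hrange⟩ := exists_strictMono_range_eq_roots (hreg a₀ ha₀).ne_zero
  have heroot : ∀ j, (f a₀).IsRoot (e j) := Set.range_subset_iff.1 hrange.subset
  choose r hcont hr using fun j => exists_continuousOn_isRoot_thomCode_eq hC.isPreconnected hf hreg
    ha₀ (Set.mem_image_of_mem (thomCode (f a₀)) (heroot j))
  have hr₀ : ∀ j, r j a₀ = e j := fun j =>
    hinj a₀ ha₀ (hr j a₀ ha₀).1 (heroot j) (hr j a₀ ha₀).2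
  have hne : ∀ i j, i < j → ∀ a ∈ C, r i a ≠ r j a := by
    intro i j hij a ha heq
    refine (he hij).ne (hinj a₀ ha₀ (heroot i) (heroot j) ?_)
    rw [← (hr i a ha).2, heq, (hr j a ha).2]
  refine ⟨k, r, fun j => thomCode (f a₀) (e j), hcont, fun a ha i j hij => ?_, fun a ha => ?_,
    fun j a ha => (hr j a ha).2⟩
  · refine lt_of_isPreconnected_of_continuousOn_of_ne hC.isPreconnected (hcont i) (hcont j)
      (hne i j hij) ha₀ ha ?_
    simpa only [hr₀] using he hij
  · refine Set.Subset.antisymm (fun z hz => ?_) (Set.range_subset_iff.2 fun j => (hr j a ha).1)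
    obtain ⟨w, hw, hcode⟩ := (rootThomCodes_eq_of_isPreconnected hC.isPreconnected hf hreg ha
      ha₀).subset (Set.mem_image_of_mem _ hz)
    obtain ⟨j, rfl⟩ := hrange.superset hw
    exact ⟨j, hinj a ha (hr j a ha).1 hz ((hr j a ha).2.trans hcode)⟩

end RootFunctions

section Resultant

variable {R S : Type*} [CommRing R] [CommRing S] (φ : R →+* S)

theorem map_resultant_eq_zero_of_common_root {p q : R[X]} {z : S}
    (hdeg : p.natDegree ≠ 0 ∨ q.natDegree ≠ 0) (hp : (p.map φ).IsRoot z)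
    (hq : (q.map φ).IsRoot z) : φ (resultant p q) = 0 := by
  obtain ⟨u, v, -, -, huv⟩ := exists_mul_add_mul_eq_C_resultant p q le_rfl le_rfl hdeg
  have heval := congrArg (fun r => (r.map φ).eval z) huv
  simpa only [Polynomial.map_add, Polynomial.map_mul, map_C, eval_add, eval_mul, eval_C,
    hp.eq_zero, hq.eq_zero, zero_mul, add_zero] using heval.symm

theorem resultant_iterate_derivative_natDegree (p : R[X]) :
    resultant p (derivative^[p.natDegree] p) =
      (p.natDegree.factorial • p.leadingCoeff) ^ p.natDegree := by
  have hdeg : (derivative^[p.natDegree] p).natDegree = 0 := by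
    simpa only [Nat.sub_self, Nat.le_zero] using natDegree_iterate_derivative p p.natDegree
  rw [hdeg, resultant_zero_right_deg, coeff_iterate_derivative, zero_add, Nat.descFactorial_self,
    coeff_natDegree]

variable {φ} {p : R[X]}

theorem map_leadingCoeff_ne_zero_of_map_resultant_ne_zero (hp : p.natDegree ≠ 0)
    (h : φ (resultant p (derivative^[p.natDegree] p)) ≠ 0) : φ p.leadingCoeff ≠ 0 := by
  intro hlead
  apply h
  rw [resultant_iterate_derivative_natDegree, map_pow, map_nsmul, hlead, smul_zero, zero_pow hp]

theorem isThomRegular_map_of_map_resultant_ne_zero (hp : p.natDegree ≠ 0)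
    (h : ∀ i, 1 ≤ i → i ≤ p.natDegree → φ (resultant p (derivative^[i] p)) ≠ 0) :
    IsThomRegular (p.map φ) where
  ne_zero hzero := map_leadingCoeff_ne_zero_of_map_resultant_ne_zero hp
    (h _ (Nat.one_le_iff_ne_zero.2 hp) le_rfl)
    (by rw [leadingCoeff, ← coeff_map, hzero, coeff_zero])
  eval_iterate_derivative_ne_zero z hz i h1 hi hzi := h i h1 (hi.trans natDegree_map_le)
    (map_resultant_eq_zero_of_common_root φ (.inl hp) hz (by rwa [← iterate_derivative_map]))

end Resultant

theorem isOpen_regularSet {n : ℕ} (p : (MvPolynomial (Fin n) ℝ)[X]) : IsOpen (regularSet p) := by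
  have hinter : regularSet p = ⋂ i ∈ Finset.Icc 1 p.natDegree,
      {a | MvPolynomial.eval a (resultant p (zDeriv p i)) ≠ 0} := by
    ext a
    simp only [regularSet, Set.mem_ofPred_eq, Set.mem_iInter, Finset.mem_Icc, and_imp]
  rw [hinter]
  exact isOpen_biInter_finset fun i _ =>
    isOpen_ne_fun (MvPolynomial.continuous_eval _) continuous_const

theorem mainTheorem1_general {T : Type*} [TopologicalSpace T] {C : Set T} (hC : IsConnected C)
    {f : T → ℝ[X]} {d : ℕ} (hcoeff : ∀ i, ContinuousOn (fun a => (f a).coeff i) C)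
    (hdeg : ∀ a ∈ C, (f a).natDegree = d) (hreg : ∀ a ∈ C, IsThomRegular (f a)) :
    ∃ (k : ℕ) (r : Fin k → T → ℝ),
      ((∀ j, ContinuousOn (r j) C) ∧
        (∀ a ∈ C, StrictMono fun j => r j a) ∧
        (∀ a ∈ C, {z : ℝ | (f a).eval z = 0} = Set.range fun j => r j a)) ∧
      ∃ σ : ℕ → Fin k → SignType,
        (∀ i, 1 ≤ i → i ≤ d → ∀ j, σ i j ≠ 0 ∧
          ∀ a ∈ C, sign ((derivative^[i] (f a)).eval (r j a)) = σ i j) ∧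
        (∀ j, ∀ a ∈ C, ∀ z : ℝ, z = r j a ↔
          ((f a).eval z = 0 ∧ ∀ i, 1 ≤ i → i ≤ d →
            sign ((derivative^[i] (f a)).eval z) = σ i j)) := by
  have hlim : ∀ a ∈ C, TendstoCoeffwise f (𝓝[C] a) (f a) := fun a ha =>
    ⟨eventually_mem_nhdsWithin.mono fun b hb => by rw [hdeg b hb, hdeg a ha],
      fun i => hcoeff i a ha⟩
  obtain ⟨k, r, s, hcont, hmono, hroots, hcode⟩ :=
    exists_root_functions_of_isConnected hC hlim hreg
  have hroot : ∀ j, ∀ a ∈ C, (f a).IsRoot (r j a) := fun j a ha =>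
    (hroots a ha).superset (Set.mem_range_self j)
  refine ⟨k, r, ⟨hcont, hmono, hroots⟩, fun i j => s j i, fun i h1 hi j =>
    ⟨?_, fun a ha => congrFun (hcode j a ha) i⟩, fun j a ha z => ⟨?_, fun ⟨hz, hsign⟩ => ?_⟩⟩
  · obtain ⟨a, ha⟩ := hC.nonempty
    exact (congrFun (hcode j a ha) i).symm.trans_ne <| sign_ne_zero.2 <|
      (hreg a ha).eval_iterate_derivative_ne_zero _ (hroot j a ha) i h1
        (hi.trans_eq (hdeg a ha).symm)
  · rintro rfl
    exact ⟨hroot j a ha, fun i _ _ => congrFun (hcode j a ha) i⟩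
  · refine thomCode_injOn_roots (hreg a ha).ne_zero hz (hroot j a ha) ?_
    refine (thomCode_eq_iff_of_isRoot (hdeg a ha).le (hdeg a ha).le hz (hroot j a ha)).2 ?_
    simpa only [thomCode, ← hcode j a ha] using hsign

theorem mainTheorem1 (n d : ℕ) (p : (MvPolynomial (Fin n) ℝ)[X])
    (hd : p.natDegree = d) (hd1 : 1 ≤ d) :
    IsOpen (regularSet p) ∧
    ∀ C : Set (Fin n → ℝ),
      (∃ a₀ ∈ regularSet p, C = connectedComponentIn (regularSet p) a₀) →
      ∃ (k : ℕ) (r : Fin k → (Fin n → ℝ) → ℝ),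
        ((∀ j, ContinuousOn (r j) C) ∧
          (∀ a ∈ C, StrictMono fun j => r j a) ∧
          (∀ a ∈ C, {z : ℝ | evalAt p z a = 0} = Set.range fun j => r j a)) ∧
        ∃ σ : ℕ → Fin k → SignType,
          (∀ i, 1 ≤ i → i ≤ d → ∀ j, σ i j ≠ 0 ∧
            ∀ a ∈ C, SignType.sign (evalAt (zDeriv p i) (r j a) a) = σ i j) ∧
          (∀ j, ∀ a ∈ C, ∀ z : ℝ, z = r j a ↔
            (evalAt p z a = 0 ∧ ∀ i, 1 ≤ i → i ≤ d →
              SignType.sign (evalAt (zDeriv p i) z a) = σ i j)) := by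
  subst hd
  refine ⟨isOpen_regularSet p, ?_⟩
  rintro _ ⟨a₀, ha₀, rfl⟩
  have hp : p.natDegree ≠ 0 := Nat.one_le_iff_ne_zero.1 hd1
  have hsub := connectedComponentIn_subset (regularSet p) a₀
  simpa only [evalAt, zDeriv, iterate_derivative_map] using mainTheorem1_general
    (f := fun a => p.map (MvPolynomial.eval a)) (isConnected_connectedComponentIn_iff.2 ha₀)
    (fun i => by
      simpa only [coeff_map] using (MvPolynomial.continuous_eval (p.coeff i)).continuousOn)
    (fun a ha => natDegree_map_of_leadingCoeff_ne_zero _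
      (map_leadingCoeff_ne_zero_of_map_resultant_ne_zero hp (hsub ha _ hd1 le_rfl)))
    (fun a ha => isThomRegular_map_of_map_resultant_ne_zero hp (hsub ha))
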